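/- Let $k\ge 2$ be an integer, put $c_k=\sqrt{k(k-1)(k+2\sqrt{2k}+2)}$, and let $n_0(k)$ be the smallest positive integer such that $n-4c_k\sqrt n-2k^2-4k-4\ge 0$ for every integer $n\ge n_0(k)$. All graphs are finite and simple; $d_G(u)$ and $N_G(u)$ denote the degree and the neighborhood of a vertex $u$ in a graph $G$. Let $\sigma_2(G)$ be the minimum of $d_G(u)+d_G(v)$ over all pairs of distinct non-adjacent vertices $u,v$ of $G$, and $\sigma_2(G)=\infty$ if $G$ is complete. A $[2,k]$-ST of $G$ is a spanning tree $T$ of $G$ with no vertex $u$ such that $2\le d_T(u)\le k$. For $n\ge 2k+1$ let $\mathcal G_{k,n}$ be the family of graphs $G$ of order $n$ for which there are sets $L_1,L_2,L_3,L_4$ such that (L1) $V(G)$ is the disjoint union of the four non-empty sets $L_1,L_2,L_3,L_4$; (L2) $L_1\cup L_2$ and $L_4$ are cliques of $G$; (L3) for every $u_1\in L_1$, $N_G(u_1)\cap(L_3\cup L_4)=\emptyset$; (L4) for every $u_2\in L_2$, $N_G(u_2)\cap L_3\ne\emptyset$, $N_G(u_2)\cap L_4=\emptyset$ and $d_G(u_2)\le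 k$; (L5) for every $u_3\in L_3$, $N_G(u_3)\cap L_2\ne\emptyset$, $L_4\subseteq N_G(u_3)$ and $d_G(u_3)\ge n-|L_1\cup L_2|-1$. **Theorem.** Let $k\ge 2$ be an integer and let $G$ be a connected graph of order $n\ge n_0(k)$ with $\sigma_2(G)\ge n-2$. Then $G$ has a $[2,k]$-ST if and only if $G$ is not isomorphic to any graph in $\mathcal G_{k,n}$. -/

import Mathlib

namespace TwoKST

section Graphs

variable {V : Type*} [Fintype V]

/-- The degree of the vertex `v` in the finite graph `G`. -/
noncomputable def deg (G : SimpleGraph V) (v : V) : ℕ := by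
  classical exact G.degree v

/-- The minimum of `deg u + deg v` over all pairs of distinct non-adjacent vertices `u`, `v`;
the infimum over the empty family is `⊤`, so this is `⊤` when `G` is complete. -/
noncomputable def sigma2 (G : SimpleGraph V) : ℕ∞ :=
  ⨅ (u : V) (v : V) (_ : u ≠ v) (_ : ¬ G.Adj u v), ((deg G u + deg G v : ℕ) : ℕ∞)

/-- `T` is a `[2,k]`-ST of `G`: a spanning tree of `G` in which no vertex has degree
`2, …, k`. A spanning subgraph of `G` is a graph `T ≤ G` on the same vertex type. -/
structure IsTwoKST (k : ℕ) (G T : SimpleGraph V) : Prop where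
  le : T ≤ G
  isTree : T.IsTree
  deg_notMem : ∀ v : V, ∀ i : ℕ, 2 ≤ i → i ≤ k → deg T v ≠ i

/-- `G` has a `[2,k]`-ST. -/
def HasTwoKST (k : ℕ) (G : SimpleGraph V) : Prop :=
  ∃ T : SimpleGraph V, IsTwoKST k G T

/-- The conditions defining the exceptional family, on a graph `G` and four sets of vertices. -/
structure Conditions (k : ℕ) (G : SimpleGraph V) (L₁ L₂ L₃ L₄ : Set V) : Prop where
  -- the vertex set is the disjoint union of four non-empty sets
  nonempty₁ : L₁.Nonempty
  nonempty₂ : L₂.Nonempty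
  nonempty₃ : L₃.Nonempty
  nonempty₄ : L₄.Nonempty
  union_eq : L₁ ∪ L₂ ∪ L₃ ∪ L₄ = Set.univ
  disjoint₁₂ : Disjoint L₁ L₂
  disjoint₁₃ : Disjoint L₁ L₃
  disjoint₁₄ : Disjoint L₁ L₄
  disjoint₂₃ : Disjoint L₂ L₃
  disjoint₂₄ : Disjoint L₂ L₄
  disjoint₃₄ : Disjoint L₃ L₄
  -- cliques
  isClique₁₂ : G.IsClique (L₁ ∪ L₂)
  isClique₄ : G.IsClique L₄
  -- vertices of the first set
  cond₁ : ∀ u ∈ L₁, G.neighborSet u ∩ (L₃ ∪ L₄) = ∅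
  -- vertices of the second set
  cond₂ : ∀ u ∈ L₂, (G.neighborSet u ∩ L₃).Nonempty ∧ G.neighborSet u ∩ L₄ = ∅ ∧ deg G u ≤ k
  -- vertices of the third set; the bound `deg u ≥ n - |L₁ ∪ L₂| - 1` is written additively
  cond₃ : ∀ u ∈ L₃, (G.neighborSet u ∩ L₂).Nonempty ∧ L₄ ⊆ G.neighborSet u ∧
    Fintype.card V ≤ deg G u + (L₁ ∪ L₂).ncard + 1

end Graphs

/-- The family of graphs of order `n`, on the vertex set `Fin n`, that satisfy `Conditions`
for some sets `L₁`, `L₂`, `L₃`, `L₄`. -/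
def family (k n : ℕ) : Set (SimpleGraph (Fin n)) :=
  {H | ∃ L₁ L₂ L₃ L₄ : Set (Fin n), Conditions k H L₁ L₂ L₃ L₄}

/-- `c_k = √(k (k - 1) (k + 2 √(2k) + 2))`. -/
noncomputable def c (k : ℕ) : ℝ :=
  √((k : ℝ) * ((k : ℝ) - 1) * ((k : ℝ) + 2 * √(2 * (k : ℝ)) + 2))

/-- The positive integers `m` such that `n - 4 c_k √n - 2k² - 4k - 4 ≥ 0` for all `n ≥ m`. -/
def thresholds (k : ℕ) : Set ℕ :=
  {m | 0 < m ∧ ∀ n : ℕ, m ≤ n →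
    0 ≤ (n : ℝ) - 4 * c k * √(n : ℝ) - 2 * (k : ℝ) ^ 2 - 4 * (k : ℝ) - 4}

/-- The set of thresholds is nonempty, so that it has a smallest element. -/
theorem thresholds_nonempty (k : ℕ) : (thresholds k).Nonempty := by
  have hc : 0 ≤ c k := Real.sqrt_nonneg _
  obtain ⟨m, hm⟩ := exists_nat_ge ((4 * c k + 2 * (k : ℝ) ^ 2 + 4 * (k : ℝ) + 4) ^ 2)
  have hD : (4 : ℝ) ≤ 2 * (k : ℝ) ^ 2 + 4 * (k : ℝ) + 4 := by
    have : (0 : ℝ) ≤ 2 * (k : ℝ) ^ 2 + 4 * (k : ℝ) := by positivity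
    linarith
  refine ⟨m + 1, Nat.succ_pos m, fun n hn => ?_⟩
  have hn' : (4 * c k + 2 * (k : ℝ) ^ 2 + 4 * (k : ℝ) + 4) ^ 2 ≤ (n : ℝ) :=
    hm.trans (by exact_mod_cast (Nat.le_succ m).trans hn)
  have hs : 4 * c k + 2 * (k : ℝ) ^ 2 + 4 * (k : ℝ) + 4 ≤ √(n : ℝ) :=
    Real.le_sqrt_of_sq_le hn'
  have hq : √(n : ℝ) * √(n : ℝ) = n := Real.mul_self_sqrt (Nat.cast_nonneg n)
  have h1 : (1 : ℝ) ≤ √(n : ℝ) := by linarith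
  nlinarith [mul_le_mul_of_nonneg_right hs (Real.sqrt_nonneg (n : ℝ)),
    mul_le_mul_of_nonneg_left h1
      (by linarith : (0 : ℝ) ≤ 2 * (k : ℝ) ^ 2 + 4 * (k : ℝ) + 4)]

/-- `n₀(k)`: the smallest positive integer `m` such that
`n - 4 c_k √n - 2k² - 4k - 4 ≥ 0` for every integer `n ≥ m`. -/
noncomputable def n₀ (k : ℕ) : ℕ := sInf (thresholds k)

end TwoKST

/-! Membership in the exceptional family amounts to a local obstruction: a vertex `a` all of whose
neighbours have degree at most k. The Ore condition makes the closed neighbourhood of such an `a` a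
clique; splitting the clique and its complement by whether a vertex has neighbours on the other side
gives the four sets (`exists_conditions`). In a [2,k]-ST every neighbour of `a` would be a leaf, so
the tree would be a star at `a`, although `a` has degree at most k (`not_hasTwoKST`).

Without the obstruction it suffices to find a connected dominating set S, with at least two
vertices, in which each vertex has k private neighbours outside S: hang the outside vertices on S as
leaves (`hasTwoKST_of_private`). Private neighbours are chosen greedily when S is small against the
degrees (`exists_private`), and averaging yields S of logarithmic size (`exists_small_cover`), small
enough once n ≥ n₀(k).

Call v low if 2 deg v + 2 < n; low vertices form a clique. If all degrees are at least n/5, a low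
vertex dominates the low ones and common neighbours connect S; a non-adjacent pair without common
neighbour dominates by itself (`hasTwoKST_of_deg_ge`). If deg a < n/5, every vertex off the closed
neighbourhood of `a` has degree at least n - 2 - deg a, and one of them serves as a hub
(`exists_connected_of_low_deg`). Low vertices are then dominated by a low vertex of degree above k,
its private neighbours reserved in advance, or else by one neighbour of degree above k for each of
them (`hasTwoKST_of_low_deg`). -/

namespace TwoKST

open SimpleGraph Finset

/-! ### Greedy covering -/

/-- If every element of `U` is related to at least a fraction `1 / (m + 1)` of `Y`, then few
elements of `Y` suffice to cover `U`. -/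
theorem exists_small_cover {α β : Type*} (r : α → β → Prop) (m : ℕ) (Y : Finset β)
    (hY : Y.Nonempty) (j : ℕ) (U : Finset α)
    (h : ∀ u ∈ U, ∃ N ⊆ Y, (∀ y ∈ N, r u y) ∧ #Y ≤ (m + 1) * #N)
    (hj : #U * m ^ j < (m + 1) ^ j) :
    ∃ Z ⊆ Y, #Z ≤ j ∧ ∀ u ∈ U, ∃ z ∈ Z, r u z := by
  classical
  induction j generalizing U with
  | zero =>
    have : U = ∅ := by simpa using hj
    exact ⟨∅, by simp, by simp, by simp [this]⟩
  | succ j ih =>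
    have hsum : ∑ _y ∈ Y, #U ≤ ∑ y ∈ Y, (m + 1) * #{u ∈ U | r u y} := by
      have h1 : ∑ y ∈ Y, #{u ∈ U | r u y} = ∑ u ∈ U, #{y ∈ Y | r u y} :=
        (Finset.sum_card_bipartiteAbove_eq_sum_card_bipartiteBelow r).symm
      rw [← Finset.mul_sum, h1, Finset.mul_sum, Finset.sum_const, smul_eq_mul, mul_comm,
        ← smul_eq_mul, ← Finset.sum_const]
      refine Finset.sum_le_sum fun u hu => ?_
      obtain ⟨N, hN, hr, hc⟩ := h u hu
      exact hc.trans (Nat.mul_le_mul_left _ (card_le_card fun y hy =>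
        mem_filter.2 ⟨hN hy, hr y hy⟩))
    -- By double counting some `y` covers a fraction 1/(m+1) of `U`; each pick thus shrinks the rest
    -- by m/(m+1).
    obtain ⟨y, hy, hyU⟩ := Finset.exists_le_of_sum_le hY hsum
    have hsplit := card_filter_add_card_filter_not (s := U) (fun u => r u y)
    have hlt : #{u ∈ U | ¬ r u y} * m ^ j < (m + 1) ^ j := by
      have h2 : (m + 1) * #{u ∈ U | ¬ r u y} ≤ m * #U := by nlinarith
      have h3 : (m + 1) * (#{u ∈ U | ¬ r u y} * m ^ j) < (m + 1) * (m + 1) ^ j := by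
        calc (m + 1) * (#{u ∈ U | ¬ r u y} * m ^ j)
            = ((m + 1) * #{u ∈ U | ¬ r u y}) * m ^ j := by ring
          _ ≤ (m * #U) * m ^ j := Nat.mul_le_mul_right _ h2
          _ = #U * m ^ (j + 1) := by ring
          _ < (m + 1) ^ (j + 1) := hj
          _ = (m + 1) * (m + 1) ^ j := by ring
      exact Nat.lt_of_mul_lt_mul_left h3
    obtain ⟨Z, hZ, hZc, hZU⟩ := ih _ (fun u hu => h u (mem_filter.1 hu).1) hlt
    refine ⟨insert y Z, insert_subset hy hZ, (card_insert_le _ _).trans (by omega), fun u hu => ?_⟩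
    by_cases hr : r u y
    · exact ⟨y, mem_insert_self _ _, hr⟩
    · obtain ⟨z, hz, hrz⟩ := hZU u (mem_filter.2 ⟨hu, hr⟩)
      exact ⟨z, mem_insert_of_mem hz, hrz⟩

/-! ### Neighbourhoods and connectivity -/

section Neighbours

variable {V : Type*} [Fintype V]

/-- The finite set of neighbours of `v`. -/
noncomputable def nbr (G : SimpleGraph V) (v : V) : Finset V := by
  classical exact univ.filter (G.Adj v)

/-- The finite closed neighbourhood of `v`. -/
noncomputable def cnbr (G : SimpleGraph V) (v : V) : Finset V := by
  classical exact insert v (nbr G v)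

variable {G : SimpleGraph V} {k : ℕ}

@[simp] theorem mem_nbr {v w : V} : w ∈ nbr G v ↔ G.Adj v w := by
  classical simp [nbr]

@[simp] theorem mem_cnbr {v w : V} : w ∈ cnbr G v ↔ w = v ∨ G.Adj v w := by
  classical simp [cnbr]

theorem card_nbr (v : V) : #(nbr G v) = deg G v := by
  classical
  rw [deg, ← card_neighborFinset_eq_degree]
  congr 1
  ext w
  simp

theorem card_cnbr (v : V) : #(cnbr G v) = deg G v + 1 := by
  classical
  rw [cnbr, card_insert_of_notMem (by simp), card_nbr]

theorem deg_mono {T : SimpleGraph V} (h : T ≤ G) (v : V) : deg T v ≤ deg G v := by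
  rw [← card_nbr, ← card_nbr]
  exact card_le_card fun w hw => by simpa using h (by simpa using hw)

theorem eq_of_deg_eq_one {v w w' : V} (h : deg G v ≤ 1) (hw : G.Adj v w) (hw' : G.Adj v w') :
    w = w' := by
  rw [← card_nbr] at h
  exact card_le_one.1 h w (by simpa using hw) w' (by simpa using hw')

theorem deg_iso {W : Type*} [Fintype W] {H : SimpleGraph W} (e : G ≃g H) (v : V) :
    deg H (e v) = deg G v := by
  classical
  rw [← card_nbr, ← card_nbr, ← card_map e.toEquiv.toEmbedding]
  congr 1
  ext w
  simp only [mem_nbr, mem_map_equiv]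
  rw [← e.map_adj_iff]
  exact iff_of_eq (congrArg _ (e.apply_symm_apply w).symm)

omit [Fintype V] in
/-- In a connected graph, a nonempty set closed under adjacency contains every vertex. -/
theorem mem_of_connected {T : SimpleGraph V} (hT : T.Connected) (S : Set V) {a : V} (ha : a ∈ S)
    (h : ∀ u ∈ S, ∀ v, T.Adj u v → v ∈ S) (v : V) : v ∈ S := by
  obtain ⟨p⟩ := hT.preconnected a v
  induction p with
  | nil => exact ha
  | cons hadj _ ih => exact ih (h _ ha _ hadj)

/-- The spanning subgraph of `G` whose edges are those inside `S`. -/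
def inside (G : SimpleGraph V) (S : Finset V) : SimpleGraph V where
  Adj u v := u ∈ S ∧ v ∈ S ∧ G.Adj u v
  symm := ⟨fun _ _ h => ⟨h.2.1, h.1, h.2.2.symm⟩⟩
  loopless := ⟨fun _ h => h.2.2.ne rfl⟩

/-- Every vertex of `S` can be reached from `r` inside `S`. -/
def ConnFrom (G : SimpleGraph V) (S : Finset V) (r : V) : Prop :=
  r ∈ S ∧ ∀ s ∈ S, (inside G S).Reachable r s

/-- The set `S` dominates all vertices of the graph. -/
def Dominates (G : SimpleGraph V) (S : Finset V) : Prop :=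
  ∀ v, ∃ s ∈ S, v = s ∨ G.Adj s v

omit [Fintype V] in
theorem reachable_step {S : Finset V} {r s t : V} (h : (inside G S).Reachable r s) (hs : s ∈ S)
    (ht : t ∈ S) (hst : t = s ∨ G.Adj s t) : (inside G S).Reachable r t := by
  rcases hst with rfl | hst
  · exact h
  · exact h.trans (Adj.reachable ⟨hs, ht, hst⟩)

omit [Fintype V] in
theorem inside_mono {S S' : Finset V} (h : S ⊆ S') : inside G S ≤ inside G S' :=
  fun _ _ ⟨hu, hv, huv⟩ => ⟨h hu, h hv, huv⟩

/-! ### Spanning trees from connected dominating sets -/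

/-- A connected dominating set in which every vertex has `k` private neighbours yields a spanning
tree without vertices of degree `2, …, k`. -/
theorem hasTwoKST_of_private {S : Finset V} {r : V} (hr : ConnFrom G S r) (hnt : ∃ t ∈ S, t ≠ r)
    (hdom : Dominates G S) (p : V → Finset V)
    (hp : ∀ s ∈ S, (∀ v ∈ p s, v ∉ S ∧ G.Adj s v) ∧ k ≤ #(p s))
    (hdisj : ∀ s ∈ S, ∀ t ∈ S, s ≠ t → Disjoint (p s) (p t)) : HasTwoKST k G := by
  classical
  have hf : ∀ v, ∃ s, s ∈ S ∧ (v ∉ S → G.Adj s v) ∧ ∀ t ∈ S, v ∈ p t → t = s := by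
    intro v
    by_cases h : ∃ s ∈ S, v ∈ p s
    · obtain ⟨s, hs, hv⟩ := h
      refine ⟨s, hs, fun _ => ((hp s hs).1 v hv).2, fun t ht hvt => ?_⟩
      by_contra hne
      exact Finset.disjoint_left.1 (hdisj t ht s hs hne) hvt hv
    · obtain ⟨s, hs, hv⟩ := hdom v
      refine ⟨s, hs, fun hvS => ?_, fun t ht hvt => (h ⟨t, ht, hvt⟩).elim⟩
      rcases hv with rfl | hv
      · exact (hvS hs).elim
      · exact hv
  choose f hfS hfadj hfp using hf
  -- Outside S only the edge from v to `f v` survives, so in any spanning tree of `H` the outside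
  -- vertices are leaves and private ones hang on their owner.
  let H : SimpleGraph V :=
    { Adj := fun u v => G.Adj u v ∧ (u ∈ S ∧ v ∈ S ∨ u ∉ S ∧ v = f u ∨ v ∉ S ∧ u = f v)
      symm := ⟨fun u v h => ⟨h.1.symm, by tauto⟩⟩
      loopless := ⟨fun u h => h.1.ne rfl⟩ }
  have hHG : H ≤ G := fun u v h => h.1
  have hin : inside G S ≤ H := fun u v h => ⟨h.2.2, Or.inl ⟨h.1, h.2.1⟩⟩
  have hreach : ∀ v, H.Reachable r v := by
    intro v
    by_cases hv : v ∈ S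
    · exact (hr.2 v hv).mono hin
    · exact ((hr.2 _ (hfS v)).mono hin).trans
        (Adj.reachable ⟨hfadj v hv, Or.inr (Or.inr ⟨hv, rfl⟩)⟩)
  have hHc : H.Connected :=
    { preconnected := fun u v => (hreach u).symm.trans (hreach v)
      nonempty := ⟨r⟩ }
  obtain ⟨T, hTH, hT⟩ := hHc.exists_isTree_le
  have hout : ∀ v ∉ S, ∀ w, T.Adj v w → w = f v := by
    intro v hv w hvw
    rcases (hTH hvw).2 with h | h | h
    · exact (hv h.1).elim
    · exact h.2
    · exact (hv (h.2 ▸ hfS w)).elim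
  have hnbr : ∀ v, ∃ w, T.Adj v w := by
    intro v
    by_contra! hno
    obtain ⟨t, _, htr⟩ := hnt
    have := mem_of_connected hT.connected {v} rfl (fun u hu w huw => by
      rw [Set.mem_singleton_iff] at hu
      subst hu
      exact (hno w huw).elim)
    exact htr ((this t).trans (this r).symm)
  have hleaf : ∀ v ∉ S, T.Adj v (f v) := by
    intro v hv
    obtain ⟨w, hw⟩ := hnbr v
    exact hout v hv w hw ▸ hw
  refine ⟨T, hTH.trans hHG, hT, fun v i h2 hik hi => ?_⟩
  by_cases hv : v ∈ S
  -- Otherwise `v` and its leaves would form the whole tree, leaving S with one vertex. This edge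
  -- raises the degree from k to k + 1.
  · have hstep : ∃ w ∈ S, T.Adj v w := by
      by_contra! hno
      have hall := mem_of_connected hT.connected {u | u = v ∨ u ∉ S ∧ f u = v} (Or.inl rfl) (by
        rintro u (rfl | ⟨hu, hfu⟩) w huw
        · have hw : w ∉ S := fun hw => hno w hw huw
          exact Or.inr ⟨hw, (hout w hw u huw.symm).symm⟩
        · exact Or.inl ((hout u hu w huw).trans hfu))
      obtain ⟨t, htS, htr⟩ := hnt
      have h1 : t = v := (hall t).resolve_right fun h => h.1 htS
      have h2 : r = v := (hall r).resolve_right fun h => h.1 hr.1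
      exact htr (h1.trans h2.symm)
    obtain ⟨w, hwS, hvw⟩ := hstep
    have hsub : insert w (p v) ⊆ nbr T v := by
      intro u hu
      rw [mem_nbr]
      rcases mem_insert.1 hu with rfl | hu
      · exact hvw
      · have hleaf' := hleaf u ((hp v hv).1 u hu).1
        rw [← hfp u v hv hu] at hleaf'
        exact hleaf'.symm
    have hcard := card_le_card hsub
    rw [card_insert_of_notMem (fun h => ((hp v hv).1 w h).1 hwS), card_nbr] at hcard
    have := (hp v hv).2
    omega
  · have : deg T v ≤ 1 := by
      rw [← card_nbr]
      refine card_le_one.2 fun a ha b hb => ?_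
      rw [hout v hv a (by simpa using ha), hout v hv b (by simpa using hb)]
    omega

/-- Greedy choice of disjoint private neighbourhoods outside `S` and `P`. -/
theorem exists_private (S P : Finset V) (S₁ : Finset V) (hS₁ : S₁ ⊆ S)
    (hdeg : ∀ s ∈ S₁, #S + #P + k * #S₁ ≤ deg G s + 1) :
    ∃ p : V → Finset V, (∀ s ∈ S₁, (∀ v ∈ p s, v ∉ S ∧ v ∉ P ∧ G.Adj s v) ∧ #(p s) = k) ∧
      ∀ s ∈ S₁, ∀ t ∈ S₁, s ≠ t → Disjoint (p s) (p t) := by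
  classical
  induction S₁ using Finset.induction_on generalizing P with
  | empty => exact ⟨fun _ => ∅, by simp, by simp⟩
  | insert a S₁ ha ih =>
    have haS : a ∈ S := hS₁ (mem_insert_self _ _)
    have hda := hdeg a (mem_insert_self _ _)
    rw [card_insert_of_notMem ha] at hda
    -- No vertex is its own neighbour, so only `S.erase a` must be avoided; this accounts for the +
    -- 1 in `hdeg`.
    have hbig : k ≤ #(nbr G a \ (S.erase a ∪ P)) := by
      have h1 := le_card_sdiff (S.erase a ∪ P) (nbr G a)
      have h2 := card_union_le (S.erase a) P
      have h3 := card_erase_add_one haS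
      rw [card_nbr] at h1
      nlinarith [Nat.zero_le (k * #S₁), Nat.sub_add_cancel (m := #(S.erase a ∪ P)) (n := deg G a)
        (by nlinarith [Nat.zero_le (k * #S₁)])]
    obtain ⟨Q, hQ, hQc⟩ := exists_subset_card_eq hbig
    have hQmem : ∀ v ∈ Q, v ∉ S ∧ v ∉ P ∧ G.Adj a v := by
      intro v hv
      have := hQ hv
      simp only [mem_sdiff, mem_nbr, mem_union, mem_erase, not_or, not_and] at this
      exact ⟨this.2.1 this.1.ne', this.2.2, this.1⟩
    obtain ⟨p, hp, hpd⟩ := ih (P ∪ Q) ((subset_insert _ _).trans hS₁) (fun s hs => by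
      have h1 := hdeg s (mem_insert_of_mem hs)
      rw [card_insert_of_notMem ha] at h1
      have h2 := card_union_le P Q
      rw [hQc] at h2
      nlinarith)
    have hne : ∀ s ∈ S₁, s ≠ a := fun s hs h => ha (h ▸ hs)
    refine ⟨Function.update p a Q, fun s hs => ?_, fun s hs t ht hst => ?_⟩
    · rcases mem_insert.1 hs with rfl | hs
      · simpa using ⟨hQmem, hQc⟩
      · rw [Function.update_of_ne (hne s hs)]
        refine ⟨fun v hv => ?_, (hp s hs).2⟩
        have := (hp s hs).1 v hv
        simp only [mem_union, not_or] at this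
        exact ⟨this.1, this.2.1.1, this.2.2⟩
    · have key : ∀ s ∈ S₁, Disjoint (p s) Q := fun s hs => by
        rw [Finset.disjoint_left]
        intro v hv hvQ
        exact ((hp s hs).1 v hv).2.1 (mem_union_right _ hvQ)
      rcases mem_insert.1 hs with rfl | hs' <;> rcases mem_insert.1 ht with rfl | ht'
      · exact (hst rfl).elim
      · rw [Function.update_self, Function.update_of_ne (hne t ht')]
        exact (key t ht').symm
      · rw [Function.update_self, Function.update_of_ne (hne s hs')]
        exact key s hs'
      · rw [Function.update_of_ne (hne s hs'), Function.update_of_ne (hne t ht')]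
        exact hpd s hs' t ht' hst

/-- A small connected dominating set of vertices of large degree yields a `[2,k]`-ST. -/
theorem hasTwoKST_of_connected_dominating {S : Finset V} {r : V} (hr : ConnFrom G S r)
    (hnt : ∃ t ∈ S, t ≠ r) (hdom : Dominates G S)
    (hdeg : ∀ s ∈ S, (k + 1) * #S ≤ deg G s + 1) : HasTwoKST k G := by
  obtain ⟨p, hp, hpd⟩ := exists_private (G := G) (k := k) S ∅ S subset_rfl (fun s hs => by
    have := hdeg s hs
    rw [card_empty]
    linarith)
  exact hasTwoKST_of_private hr hnt hdom p
    (fun s hs => ⟨fun v hv => ⟨((hp s hs).1 v hv).1, ((hp s hs).1 v hv).2.2⟩, (hp s hs).2.ge⟩) hpd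

/-- As `hasTwoKST_of_connected_dominating`, where one vertex `b` of small degree is allowed
if `k` neighbours of `b` lie outside the dominating set. -/
theorem hasTwoKST_of_connected_dominating_insert {S P : Finset V} {r b : V} (hr : ConnFrom G S r)
    (hnt : ∃ t ∈ S, t ≠ r) (hdom : Dominates G S) (hbS : b ∈ S) (hPc : #P = k)
    (hP : ∀ v ∈ P, v ∉ S ∧ G.Adj b v)
    (hdeg : ∀ s ∈ S, s ≠ b → (k + 1) * #S ≤ deg G s + 1) : HasTwoKST k G := by
  classical
  obtain ⟨p, hp, hpd⟩ := exists_private (G := G) (k := k) S P (S.erase b) (erase_subset _ _)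
    (fun s hs => by
      have h1 := hdeg s (mem_of_mem_erase hs) (ne_of_mem_erase hs)
      have h2 := card_erase_add_one hbS
      rw [← h2] at h1 ⊢
      nlinarith)
  have hout : ∀ s ∈ S, s ≠ b → Disjoint (p s) P := fun s hs hsb => by
    rw [Finset.disjoint_left]
    exact fun v hv hvP => ((hp s (mem_erase.2 ⟨hsb, hs⟩)).1 v hv).2.1 hvP
  refine hasTwoKST_of_private hr hnt hdom (Function.update p b P) (fun s hs => ?_)
    (fun s hs t ht hst => ?_)
  · by_cases hsb : s = b
    · subst hsb
      simpa using ⟨hP, hPc.ge⟩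
    · rw [Function.update_of_ne hsb]
      have := hp s (mem_erase.2 ⟨hsb, hs⟩)
      exact ⟨fun v hv => ⟨(this.1 v hv).1, (this.1 v hv).2.2⟩, this.2.ge⟩
  · by_cases hsb : s = b
    · subst hsb
      rw [Function.update_self, Function.update_of_ne hst.symm]
      exact (hout t ht hst.symm).symm
    · by_cases htb : t = b
      · subst htb
        rw [Function.update_self, Function.update_of_ne hst]
        exact hout s hs hst
      · rw [Function.update_of_ne hsb, Function.update_of_ne htb]
        exact hpd s (mem_erase.2 ⟨hsb, hs⟩) t (mem_erase.2 ⟨htb, ht⟩) hst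

end Neighbours

/-! ### The exceptional family as a local obstruction -/

section Exceptional

variable {V : Type*} [Fintype V] {G : SimpleGraph V} {k : ℕ}

/-- A graph in the exceptional family has a vertex all of whose neighbours have degree at
most `k`. -/
theorem Conditions.exists_neighbors_deg_le {L₁ L₂ L₃ L₄ : Set V}
    (h : Conditions k G L₁ L₂ L₃ L₄) : ∃ a, ∀ c, G.Adj a c → deg G c ≤ k := by
  have hnb : ∀ u ∈ L₁, ∀ c, G.Adj u c → c ∈ L₁ ∪ L₂ := by
    intro u hu c huc
    have h1 : c ∉ L₃ ∪ L₄ := fun hc => by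
      have : c ∈ G.neighborSet u ∩ (L₃ ∪ L₄) := ⟨huc, hc⟩
      rw [h.cond₁ u hu] at this
      exact this
    have h2 : c ∈ L₁ ∪ L₂ ∪ L₃ ∪ L₄ := h.union_eq ▸ Set.mem_univ c
    simp only [Set.mem_union] at h1 h2 ⊢
    tauto
  obtain ⟨a, ha⟩ := h.nonempty₁
  obtain ⟨b, hb⟩ := h.nonempty₂
  refine ⟨a, fun c hac => ?_⟩
  rcases hnb a ha c hac with hc | hc
  -- A vertex of `L₁` sees only the clique `L₁ ∪ L₂`, hence has degree at most that of `b`.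
  · have hsub : cnbr G c ⊆ cnbr G b := by
      intro w hw
      have hw' : w ∈ L₁ ∪ L₂ := by
        rcases mem_cnbr.1 hw with rfl | hw
        · exact Or.inl hc
        · exact hnb c hc w hw
      rw [mem_cnbr]
      by_cases hwb : w = b
      · exact Or.inl hwb
      · exact Or.inr (h.isClique₁₂ (Or.inr hb) hw' (Ne.symm hwb))
    have := card_le_card hsub
    rw [card_cnbr, card_cnbr] at this
    have := (h.cond₂ b hb).2.2
    omega
  · exact (h.cond₂ c hc).2.2

variable (hσ : ∀ u v, u ≠ v → ¬ G.Adj u v → Fintype.card V ≤ deg G u + deg G v + 2)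
  {a : V} (ha : ∀ c, G.Adj a c → deg G c ≤ k)

include hσ ha

/-- Two neighbours of `a` have degree sum at most 2k < n - 2, so the Ore condition forces an edge.
-/
theorem adj_of_mem_cnbr (hn : 2 * k + 2 < Fintype.card V) {u v : V} (hu : u ∈ cnbr G a)
    (hv : v ∈ cnbr G a) (huv : u ≠ v) : G.Adj u v := by
  rw [mem_cnbr] at hu hv
  rcases hu with rfl | hu
  · exact hv.resolve_left huv.symm
  · rcases hv with rfl | hv
    · exact hu.symm
    · by_contra hadj
      have := hσ u v huv hadj
      have := ha u hu
      have := ha v hv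
      omega

theorem deg_le_of_neighbors_deg_le (hn : 2 * k + 2 < Fintype.card V) : deg G a ≤ k := by
  rcases (nbr G a).eq_empty_or_nonempty with h | ⟨c, hc⟩
  · rw [← card_nbr, h]
    simp
  · have hc' := mem_nbr.1 hc
    have hsub : cnbr G a ⊆ cnbr G c := by
      intro w hw
      rw [mem_cnbr]
      by_cases hwc : w = c
      · exact Or.inl hwc
      · exact Or.inr (adj_of_mem_cnbr hσ ha hn (mem_cnbr.2 (Or.inr hc')) hw (Ne.symm hwc))
    have := card_le_card hsub
    rw [card_cnbr, card_cnbr] at this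
    have := ha c hc'
    omega

/-- If all neighbours of some vertex have degree at most `k`, there is no `[2,k]`-ST. -/
theorem not_hasTwoKST (hn : 2 * k + 2 < Fintype.card V) : ¬ HasTwoKST k G := by
  rintro ⟨T, hT⟩
  have hclosed : ∀ c, T.Adj a c → ∀ w, T.Adj c w → w = a := by
    intro c hac w hcw
    refine eq_of_deg_eq_one (G := T) (v := c) ?_ hcw hac.symm
    by_contra hlt
    exact hT.deg_notMem c (deg T c) (by omega)
      ((deg_mono hT.le c).trans (ha c (hT.le hac))) rfl
  have hall := mem_of_connected hT.isTree.connected {v | v = a ∨ T.Adj a v} (Or.inl rfl) (by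
    rintro u (rfl | hu) w huw
    · exact Or.inr huw
    · exact Or.inl (hclosed u hu w huw))
  have hsub : univ ⊆ cnbr G a := fun v _ =>
    mem_cnbr.2 ((hall v).imp id fun h => hT.le h)
  have h1 := card_le_card hsub
  rw [card_cnbr, card_univ] at h1
  have := deg_le_of_neighbors_deg_le hσ ha hn
  omega

/-- If all neighbours of some vertex have degree at most `k`, the graph is exceptional. -/
theorem exists_conditions (hG : G.Connected) (hn : 2 * k + 2 < Fintype.card V)
    (hn' : k * k + k + 1 < Fintype.card V) :
    ∃ L₁ L₂ L₃ L₄ : Set V, Conditions k G L₁ L₂ L₃ L₄ := by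
  classical
  have hda := deg_le_of_neighbors_deg_le hσ ha hn
  have hcl : ∀ u ∈ cnbr G a, ∀ v ∈ cnbr G a, u ≠ v → G.Adj u v :=
    fun u hu v hv => adj_of_mem_cnbr hσ ha hn hu hv
  have haa : a ∈ cnbr G a := mem_cnbr.2 (Or.inl rfl)
  let L₁ : Set V := {v | v ∈ cnbr G a ∧ ∀ w, G.Adj v w → w ∈ cnbr G a}
  let L₂ : Set V := {v | v ∈ cnbr G a ∧ ∃ w, G.Adj v w ∧ w ∉ cnbr G a}
  let L₃ : Set V := {v | v ∉ cnbr G a ∧ ∃ w, G.Adj v w ∧ w ∈ cnbr G a}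
  let L₄ : Set V := {v | v ∉ cnbr G a ∧ ∀ w, G.Adj v w → w ∉ cnbr G a}
  have h12 : L₁ ∪ L₂ = (cnbr G a : Set V) := by
    ext v
    simp only [L₁, L₂, Set.mem_union, Set.mem_ofPred_eq, mem_coe]
    constructor
    · tauto
    · intro hv
      by_cases h : ∀ w, G.Adj v w → w ∈ cnbr G a
      · exact Or.inl ⟨hv, h⟩
      · push Not at h
        exact Or.inr ⟨hv, h⟩
  have hdeg : ∀ v ∉ cnbr G a, Fintype.card V ≤ deg G a + deg G v + 2 := by
    intro v hv
    rw [mem_cnbr, not_or] at hv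
    exact hσ a v (Ne.symm hv.1) hv.2
  -- The Ore bound for `a` and `v` forces the closed neighbourhood of `v` to fill the complement of
  -- that of `a`.
  have hL₄ : ∀ v ∈ L₄, ∀ w ∉ cnbr G a, w ≠ v → G.Adj v w := by
    intro v hv w hw hwv
    have hsub : cnbr G v ⊆ (cnbr G a)ᶜ := by
      intro x hx
      rw [mem_compl]
      rcases mem_cnbr.1 hx with rfl | hx
      · exact hv.1
      · exact hv.2 x hx
    have heq : cnbr G v = (cnbr G a)ᶜ := by
      refine eq_of_subset_of_card_le hsub ?_
      rw [card_compl, card_cnbr, card_cnbr]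
      have := hdeg v hv.1
      omega
    have hw' : w ∈ cnbr G v := by
      rw [heq, mem_compl]
      exact hw
    exact (mem_cnbr.1 hw').resolve_left hwv
  have hne₂ : L₂.Nonempty := by
    by_contra hne
    rw [Set.not_nonempty_iff_eq_empty] at hne
    have hall := mem_of_connected hG (cnbr G a : Set V) haa (fun u hu v huv => by
      by_contra hv
      have : u ∈ L₂ := ⟨hu, v, huv, hv⟩
      rw [hne] at this
      exact this)
    have h1 := card_le_card (show univ ⊆ cnbr G a from fun v _ => hall v)
    rw [card_cnbr, card_univ] at h1
    omega
  refine ⟨L₁, L₂, L₃, L₄, ?_⟩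
  exact
  { nonempty₁ := ⟨a, haa, fun w hw => mem_cnbr.2 (Or.inr hw)⟩
    nonempty₂ := hne₂
    nonempty₃ := by
      obtain ⟨v, hv, w, hvw, hw⟩ := hne₂
      exact ⟨w, hw, v, hvw.symm, hv⟩
    nonempty₄ := by
      by_contra hne
      rw [Set.not_nonempty_iff_eq_empty] at hne
      -- If `L₄` is empty, all vertices lie within distance two of `a`: at most (k + 1) + k² of
      -- them.
      have hsub : univ ⊆ cnbr G a ∪ (nbr G a).biUnion (nbr G) := by
        intro v _
        by_contra hv
        rw [mem_union, not_or] at hv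
        have : v ∈ L₄ := ⟨hv.1, fun w hvw hw => by
          rcases mem_cnbr.1 hw with rfl | hw
          · exact hv.1 (mem_cnbr.2 (Or.inr hvw.symm))
          · exact hv.2 (mem_biUnion.2 ⟨w, mem_nbr.2 hw, mem_nbr.2 hvw.symm⟩)⟩
        rw [hne] at this
        exact this
      have h1 := (card_le_card hsub).trans (card_union_le _ _)
      have h2 : #((nbr G a).biUnion (nbr G)) ≤ #(nbr G a) * k :=
        card_biUnion_le_card_mul _ _ _ fun c hc => by
          rw [card_nbr]
          exact ha c (mem_nbr.1 hc)
      rw [card_univ, card_cnbr] at h1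
      rw [card_nbr] at h2
      have := Nat.mul_le_mul_right k hda
      omega
    union_eq := by
      rw [Set.union_assoc, h12]
      ext v
      simp only [L₃, L₄, Set.mem_union, Set.mem_ofPred_eq, mem_coe, Set.mem_univ, iff_true]
      by_cases hv : v ∈ cnbr G a
      · exact Or.inl hv
      · refine Or.inr ?_
        by_cases h : ∀ w, G.Adj v w → w ∉ cnbr G a
        · exact Or.inr ⟨hv, h⟩
        · push Not at h
          exact Or.inl ⟨hv, h⟩
    disjoint₁₂ := Set.disjoint_left.2 fun v h ⟨_, w, hvw, hw⟩ => hw (h.2 w hvw)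
    disjoint₁₃ := Set.disjoint_left.2 fun v h h' => h'.1 h.1
    disjoint₁₄ := Set.disjoint_left.2 fun v h h' => h'.1 h.1
    disjoint₂₃ := Set.disjoint_left.2 fun v h h' => h'.1 h.1
    disjoint₂₄ := Set.disjoint_left.2 fun v h h' => h'.1 h.1
    disjoint₃₄ := Set.disjoint_left.2 fun v ⟨_, w, hvw, hw⟩ h => h.2 w hvw hw
    isClique₁₂ := by
      rw [h12]
      exact fun u hu v hv huv => hcl u hu v hv huv
    isClique₄ := fun u hu v hv huv => hL₄ u hu v hv.1 (Ne.symm huv)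
    cond₁ := by
      intro u hu
      rw [Set.eq_empty_iff_forall_notMem]
      rintro w ⟨huw, hw | hw⟩
      · exact hw.1 (hu.2 w huw)
      · exact hw.1 (hu.2 w huw)
    cond₂ := by
      rintro u ⟨hu, w, huw, hw⟩
      refine ⟨⟨w, huw, hw, u, huw.symm, hu⟩, ?_, ?_⟩
      · rw [Set.eq_empty_iff_forall_notMem]
        rintro x ⟨hux, hx⟩
        exact hx.2 u (show G.Adj u x from hux).symm hu
      · rcases mem_cnbr.1 hu with rfl | hu
        · exact hda
        · exact ha u hu
    cond₃ := by
      rintro u ⟨hu, w, huw, hw⟩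
      refine ⟨⟨w, huw, hw, u, huw.symm, hu⟩, fun x hx => ?_, ?_⟩
      · refine (hL₄ x hx u hu ?_).symm
        rintro rfl
        exact hx.2 w huw hw
      · rw [h12, Set.ncard_coe_finset, card_cnbr]
        have := hdeg u hu
        omega }

end Exceptional

/-! ### The Ore condition and isomorphic copies -/

/-- The pairwise form of the bound on `sigma2`. -/
theorem card_le_of_le_sigma2 {V : Type*} [Fintype V] {G : SimpleGraph V} {n : ℕ}
    (h : ((n - 2 : ℕ) : ℕ∞) ≤ sigma2 G) (u v : V) (huv : u ≠ v) (hadj : ¬ G.Adj u v) :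
    n ≤ deg G u + deg G v + 2 := by
  have h1 : sigma2 G ≤ ((deg G u + deg G v : ℕ) : ℕ∞) :=
    iInf_le_of_le u (iInf_le_of_le v (iInf_le_of_le huv (iInf_le _ hadj)))
  have h2 : n - 2 ≤ deg G u + deg G v := by exact_mod_cast h.trans h1
  omega

theorem exists_mem_family {V : Type*} [Fintype V] {G : SimpleGraph V} {k : ℕ}
    (hσ : ∀ u v, u ≠ v → ¬ G.Adj u v → Fintype.card V ≤ deg G u + deg G v + 2)
    {a : V} (ha : ∀ c, G.Adj a c → deg G c ≤ k) (hG : G.Connected)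
    (hn : 2 * k + 2 < Fintype.card V) (hn' : k * k + k + 1 < Fintype.card V) :
    ∃ H ∈ family k (Fintype.card V), Nonempty (G ≃g H) := by
  let e := Fintype.equivFin V
  let H : SimpleGraph (Fin (Fintype.card V)) := G.map e.toEmbedding
  let f : G ≃g H := Iso.map e G
  have hadj : ∀ u v, H.Adj u v ↔ G.Adj (f.symm u) (f.symm v) := fun u v =>
    (f.symm.map_adj_iff).symm
  have hdeg : ∀ u, deg H u = deg G (f.symm u) := fun u => (deg_iso f.symm u).symm
  refine ⟨H, exists_conditions (a := f a) ?_ ?_ (f.connected_iff.1 hG) ?_ ?_, ⟨f⟩⟩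
  · intro u v huv h
    rw [hadj] at h
    rw [hdeg, hdeg, Fintype.card_fin]
    exact hσ _ _ (fun h' => huv (f.symm.injective h')) h
  · intro c hc
    rw [hadj, f.symm_apply_apply] at hc
    rw [hdeg]
    exact ha _ hc
  · rwa [Fintype.card_fin]
  · rwa [Fintype.card_fin]

theorem exists_neighbors_deg_le_of_iso {V : Type*} [Fintype V] {G : SimpleGraph V} {k n : ℕ}
    {H : SimpleGraph (Fin n)} (hH : H ∈ family k n) (e : G ≃g H) :
    ∃ a, ∀ c, G.Adj a c → deg G c ≤ k := by
  obtain ⟨L₁, L₂, L₃, L₄, hL⟩ := hH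
  obtain ⟨a, ha⟩ := hL.exists_neighbors_deg_le
  refine ⟨e.symm a, fun c hc => ?_⟩
  rw [← deg_iso e]
  refine ha _ ?_
  rw [← e.map_adj_iff] at hc
  rwa [e.apply_symm_apply] at hc

/-! ### Numerical bounds -/

/-- The defining inequality of the threshold holds above `n₀ k`. -/
theorem threshold_ineq {k n : ℕ} (hn : n₀ k ≤ n) :
    0 ≤ (n : ℝ) - 4 * c k * √(n : ℝ) - 2 * (k : ℝ) ^ 2 - 4 * (k : ℝ) - 4 :=
  (Nat.sInf_mem (thresholds_nonempty k)).2 n hn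

/-- The threshold inequality gives n ≥ 16 c_k², and √(2k) ≥ 2 gives c_k² ≥ k(k-1)(k+6). -/
theorem lower_bound_of_n₀_le {k n : ℕ} (hk : 2 ≤ k) (hn : n₀ k ≤ n) :
    289 ≤ n ∧ 16 * k * (k - 1) * (k + 6) ≤ n := by
  have h := threshold_ineq hn
  have hk' : (2 : ℝ) ≤ k := by exact_mod_cast hk
  have hc0 : 0 ≤ c k := Real.sqrt_nonneg _
  have hs : √(n : ℝ) * √(n : ℝ) = n := Real.mul_self_sqrt (Nat.cast_nonneg n)
  have hs0 : 0 ≤ √(n : ℝ) := Real.sqrt_nonneg _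
  have h2 : (2 : ℝ) ≤ √(2 * (k : ℝ)) := Real.le_sqrt_of_sq_le (by linarith)
  have hkk : (2 : ℝ) ≤ k * (k - 1) := by nlinarith
  have hc2 : (k : ℝ) * (k - 1) * (k + 6) ≤ c k ^ 2 := by
    rw [c, Real.sq_sqrt (by
      have := Real.sqrt_nonneg (2 * (k : ℝ))
      nlinarith)]
    nlinarith
  have hc4 : 4 ≤ c k := by nlinarith
  have hpos : 0 < √(n : ℝ) := by
    rcases hs0.eq_or_lt with h0 | h0
    · rw [← h0] at h hs
      nlinarith
    · exact h0
  have h4 : 4 * c k ≤ √(n : ℝ) := by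
    by_contra! hlt
    nlinarith
  constructor
  -- With c_k ≥ 4 and constants of at least 20, √n(√n - 16) ≥ 20, whereas √n < 17 would make it less
  -- than 17.
  · have h17 : 17 ≤ √(n : ℝ) := by
      by_contra! hlt
      nlinarith
    have : (289 : ℝ) ≤ n := by nlinarith
    exact_mod_cast this
  · have h5 : 16 * (k : ℝ) * (k - 1) * (k + 6) ≤ n := by nlinarith
    have h6 : ((16 * k * (k - 1) * (k + 6) : ℕ) : ℝ) ≤ (n : ℝ) := by
      push_cast [Nat.cast_sub (show 1 ≤ k by omega)]
      exact h5
    exact_mod_cast h6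

theorem two_mul_add_three_sq_le (L : ℕ) (hL : 9 ≤ L) : (2 * L + 3) ^ 2 ≤ 2 ^ L := by
  induction L, hL using Nat.le_induction with
  | base => norm_num
  | succ m hm ih =>
    calc (2 * (m + 1) + 3) ^ 2 ≤ (2 * m + 3) ^ 2 * 2 := by nlinarith
      _ ≤ 2 ^ m * 2 := Nat.mul_le_mul_right 2 ih
      _ = 2 ^ (m + 1) := (pow_succ 2 m).symm

/-- The numerical inequalities used for graphs of order at least `n₀ k`. -/
theorem size_bounds {k n : ℕ} (hk : 2 ≤ k) (hn : n₀ k ≤ n) :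
    5 * ((k + 1) * (2 * Nat.log 2 n + 3)) ≤ n ∧
    2 * ((k + 1) * (5 * (Nat.log 2 n - 1) + 2 * k + 4)) ≤ n ∧
    60 * k + 120 ≤ n ∧ k * k + k + 1 < n := by
  obtain ⟨h1, h2⟩ := lower_bound_of_n₀_le hk hn
  have hlog : 2 ^ Nat.log 2 n ≤ n := Nat.pow_log_le_self 2 (by omega)
  have hlog' : n < 2 ^ (Nat.log 2 n + 1) := Nat.lt_pow_succ_log_self (by norm_num) n
  set L := Nat.log 2 n
  have hL8 : 8 ≤ L := by
    by_contra! hlt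
    have : 2 ^ (L + 1) ≤ 2 ^ 8 := Nat.pow_le_pow_right (by norm_num) (by omega)
    omega
  obtain ⟨M, hM⟩ : ∃ M, L = M + 1 := ⟨L - 1, by omega⟩
  rcases hk.eq_or_lt with rfl | hk3
  -- At k = 2, L = 8 the first bound reads 285 ≤ n, which needs 289 rather than 2 ^ 8.
  · rcases hL8.eq_or_lt with h8 | h9
    · rw [← h8]
      norm_num
      omega
    · have h3 := two_mul_add_three_sq_le L h9
      rw [hM] at h3 hlog ⊢
      simp only [Nat.add_sub_cancel]
      have : 8 ≤ M := by omega
      refine ⟨by nlinarith, by nlinarith, by omega, by omega⟩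
  · obtain ⟨m, rfl⟩ : ∃ m, k = m + 3 := ⟨k - 3, by omega⟩
    have h52 : 52 * (m + 3 + 1) ^ 2 ≤ n := by
      refine le_trans ?_ h2
      rw [show m + 3 - 1 = m + 2 by omega]
      nlinarith
    have h9 : 9 ≤ L := by
      by_contra! hlt
      have : 2 ^ (L + 1) ≤ 2 ^ 9 := Nat.pow_le_pow_right (by norm_num) (by omega)
      nlinarith
    have h3 := (two_mul_add_three_sq_le L h9).trans hlog
    -- The factor 7 instead of 5 leaves room in the second bound for the term quadratic in k, which
    -- `h52` controls.
    have h7 : 7 * ((m + 3 + 1) * (2 * L + 3)) ≤ n := by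
      have : (7 * ((m + 3 + 1) * (2 * L + 3))) ^ 2 ≤ n ^ 2 := by
        calc (7 * ((m + 3 + 1) * (2 * L + 3))) ^ 2
            = (49 * (m + 3 + 1) ^ 2) * (2 * L + 3) ^ 2 := by ring
          _ ≤ n * n := Nat.mul_le_mul (by omega) h3
          _ = n ^ 2 := by ring
      exact (Nat.pow_le_pow_iff_left (by norm_num)).1 this
    rw [hM] at h7 ⊢
    simp only [Nat.add_sub_cancel]
    refine ⟨by omega, ?_, by nlinarith, by nlinarith⟩
    nlinarith

/-! ### Small connected dominating sets -/

section Construction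

variable {V : Type*} [Fintype V] {G : SimpleGraph V} {k : ℕ}

omit [Fintype V] in
theorem connFrom_of_hub {S : Finset V} {r : V} (hr : r ∈ S)
    (h : ∀ s ∈ S, ∃ x ∈ S, (x = r ∨ G.Adj r x) ∧ (s = x ∨ G.Adj x s)) : ConnFrom G S r := by
  refine ⟨hr, fun s hs => ?_⟩
  obtain ⟨x, hx, hrx, hxs⟩ := h s hs
  exact reachable_step (reachable_step (Reachable.refl r) hr hx hrx) hx hs hxs

omit [Fintype V] in
theorem ConnFrom.insert_of_adj [DecidableEq V] {S : Finset V} {r x b : V} (h : ConnFrom G S r)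
    (hx : x ∈ S) (hxb : G.Adj x b) : ConnFrom G (insert b S) r := by
  have hsub : S ⊆ insert b S := subset_insert b S
  refine ⟨hsub h.1, fun s hs => ?_⟩
  rcases mem_insert.1 hs with rfl | hs
  · exact reachable_step ((h.2 x hx).mono (inside_mono hsub)) (hsub hx) (mem_insert_self _ _)
      (Or.inr hxb)
  · exact (h.2 s hs).mono (inside_mono hsub)

section Ore

variable (hσ : ∀ u v, u ≠ v → ¬ G.Adj u v → Fintype.card V ≤ deg G u + deg G v + 2)

include hσ

/-- The low vertices form a clique, so any one of them dominates all the others. -/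
theorem adj_of_low_deg {u v : V} (hu : 2 * deg G u + 2 < Fintype.card V)
    (hv : 2 * deg G v + 2 < Fintype.card V) (huv : u ≠ v) : G.Adj u v := by
  by_contra h
  have := hσ u v huv h
  omega

/-- Two non-adjacent vertices without common neighbour dominate the graph, and extend to a
connected dominating set of at most four vertices. -/
theorem exists_connected_dominating_of_no_common_nbr (hG : G.Connected) {u v : V} (huv : u ≠ v)
    (hadj : ¬ G.Adj u v) (hno : ∀ w, G.Adj u w → ¬ G.Adj w v) :
    ∃ S : Finset V, ConnFrom G S u ∧ v ∈ S ∧ Dominates G S ∧ #S ≤ 4 := by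
  classical
  have hdisj : Disjoint (nbr G u) (nbr G v) := by
    rw [Finset.disjoint_left]
    intro w hw hw'
    exact hno w (mem_nbr.1 hw) (mem_nbr.1 hw').symm
  have hsub : nbr G u ∪ nbr G v ⊆ ({u, v} : Finset V)ᶜ := by
    intro w hw
    simp only [mem_union, mem_nbr] at hw
    simp only [mem_compl, mem_insert, mem_singleton, not_or]
    constructor
    · rintro rfl
      exact hw.elim (fun h => h.ne rfl) (fun h => hadj h.symm)
    · rintro rfl
      exact hw.elim hadj (fun h => h.ne rfl)
  -- The neighbourhoods are disjoint with at least n - 2 vertices together, so they exhaust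
  -- everything but u and v.
  have heq := eq_of_subset_of_card_le hsub (by
    rw [card_compl, card_pair huv, card_union_of_disjoint hdisj, card_nbr, card_nbr]
    have := hσ u v huv hadj
    omega)
  have hcov : ∀ w, w ∉ cnbr G u → w = v ∨ G.Adj v w := by
    intro w hw
    rw [mem_cnbr, not_or] at hw
    by_cases hwv : w = v
    · exact Or.inl hwv
    · have : w ∈ nbr G u ∪ nbr G v := by
        rw [heq]
        simp [hw.1, hwv]
      rw [mem_union, mem_nbr, mem_nbr] at this
      exact Or.inr (this.resolve_left hw.2)
  obtain ⟨x, hx, y, hxy, hy⟩ : ∃ x ∈ cnbr G u, ∃ y, G.Adj x y ∧ y ∉ cnbr G u := by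
    by_contra! hcl
    have := mem_of_connected hG (cnbr G u : Set V) (a := u) (by simp)
      (fun x hx y hxy => hcl x hx y hxy) v
    simp only [mem_coe, mem_cnbr] at this
    exact this.elim huv.symm hadj
  have hyv : v = y ∨ G.Adj y v := (hcov y hy).imp Eq.symm Adj.symm
  refine ⟨{u, x, y, v}, ⟨by simp, ?_⟩, by simp, fun w => ?_, card_le_four⟩
  · have h1 := reachable_step (Reachable.refl (G := inside G {u, x, y, v}) u) (by simp)
      (show x ∈ _ by simp) (mem_cnbr.1 hx)
    have h2 := reachable_step h1 (by simp) (show y ∈ _ by simp) (Or.inr hxy)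
    have h3 := reachable_step h2 (by simp) (show v ∈ _ by simp) hyv
    intro s hs
    simp only [mem_insert, mem_singleton] at hs
    rcases hs with rfl | rfl | rfl | rfl
    · exact Reachable.refl _
    · exact h1
    · exact h2
    · exact h3
  · by_cases hw : w ∈ cnbr G u
    · exact ⟨u, by simp, mem_cnbr.1 hw⟩
    · exact ⟨v, by simp, hcov w hw⟩

/-- The case of large minimum degree. -/
theorem hasTwoKST_of_deg_ge (hG : G.Connected) (L : ℕ) (hL : Fintype.card V < 2 ^ (L + 1))
    (hL1 : 1 ≤ L) (hdeg : ∀ v, (k + 1) * (2 * L + 3) ≤ deg G v + 1) : HasTwoKST k G := by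
  classical
  by_cases hcn : ∀ u v, u ≠ v → ¬ G.Adj u v → ∃ w, G.Adj u w ∧ G.Adj w v
  · have hlow : ∃ a, ∀ v, 2 * deg G v + 2 < Fintype.card V → v = a ∨ G.Adj a v := by
      by_cases h : ∃ a, 2 * deg G a + 2 < Fintype.card V
      · obtain ⟨a, ha⟩ := h
        refine ⟨a, fun v hv => ?_⟩
        by_cases hva : v = a
        · exact Or.inl hva
        · exact Or.inr (adj_of_low_deg hσ ha hv (Ne.symm hva))
      · obtain ⟨a⟩ := hG.nonempty
        exact ⟨a, fun v hv => (h ⟨v, hv⟩).elim⟩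
    obtain ⟨a, ha⟩ := hlow
    have hmid : ∀ z, ∃ x, (x = a ∨ G.Adj a x) ∧ (z = x ∨ G.Adj x z) := by
      intro z
      by_cases hz : z = a
      · exact ⟨a, Or.inl rfl, Or.inl hz⟩
      · by_cases hza : G.Adj a z
        · exact ⟨z, Or.inr hza, Or.inl rfl⟩
        · obtain ⟨w, hw, hwz⟩ := hcn a z (Ne.symm hz) hza
          exact ⟨w, Or.inr hw, Or.inr hwz⟩
    choose m hm using hmid
    -- A vertex that is not low has a closed neighbourhood of at least n/2 vertices, so each pick
    -- halves the rest.
    obtain ⟨Z, -, hZc, hZ⟩ := exists_small_cover (fun u y : V => u = y ∨ G.Adj y u) 1 univ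
      ⟨a, mem_univ a⟩ (L + 1) {u : V | Fintype.card V ≤ 2 * deg G u + 2}
      (fun u hu => ⟨cnbr G u, subset_univ _,
        fun y hy => (mem_cnbr.1 hy).imp Eq.symm Adj.symm, by
          rw [card_cnbr, card_univ]
          have := (mem_filter.1 hu).2
          omega⟩)
      (by
        rw [one_pow, mul_one]
        exact (card_le_univ _).trans_lt hL)
    let S : Finset V := insert a (Z ∪ Z.image m)
    have hS : #S ≤ 2 * L + 3 := by
      have h1 := card_insert_le a (Z ∪ Z.image m)
      have h2 := card_union_le Z (Z.image m)
      have h3 : #(Z.image m) ≤ #Z := card_image_le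
      have : #S ≤ _ := h1
      omega
    have hdom : Dominates G S := by
      intro v
      by_cases hv : 2 * deg G v + 2 < Fintype.card V
      · exact ⟨a, mem_insert_self _ _, ha v hv⟩
      · obtain ⟨z, hz, hvz⟩ := hZ v (mem_filter.2 ⟨mem_univ v, not_lt.1 hv⟩)
        exact ⟨z, mem_insert_of_mem (mem_union_left _ hz), hvz⟩
    have hconn : ConnFrom G S a := connFrom_of_hub (mem_insert_self _ _) fun s hs => by
      rcases mem_insert.1 hs with rfl | hs
      · exact ⟨s, mem_insert_self _ _, Or.inl rfl, Or.inl rfl⟩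
      · rcases mem_union.1 hs with hs | hs
        · exact ⟨m s, mem_insert_of_mem (mem_union_right _ (mem_image_of_mem m hs)), hm s⟩
        · obtain ⟨z, hz, rfl⟩ := mem_image.1 hs
          exact ⟨m z, mem_insert_of_mem (mem_union_right _ (mem_image_of_mem m hz)), (hm z).1,
            Or.inl rfl⟩
    by_cases hnt : ∃ t ∈ S, t ≠ a
    · exact hasTwoKST_of_connected_dominating hconn hnt hdom fun s _ =>
        (Nat.mul_le_mul_left _ hS).trans (hdeg s)
    -- Here S = {a}; any neighbour of `a` supplies the required second vertex.
    · push Not at hnt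
      obtain ⟨t, ht⟩ : ∃ t, G.Adj a t := by
        have h1 : 0 < #(nbr G a) := by
          rw [card_nbr]
          nlinarith [hdeg a]
        obtain ⟨t, ht⟩ := card_pos.1 h1
        exact ⟨t, mem_nbr.1 ht⟩
      refine hasTwoKST_of_connected_dominating (hconn.insert_of_adj (mem_insert_self _ _) ht)
        ⟨t, mem_insert_self _ _, ht.ne'⟩ (fun v => ?_) fun s _ => ?_
      · obtain ⟨s, hs, hvs⟩ := hdom v
        exact ⟨s, mem_insert_of_mem hs, hvs⟩
      · have h1 := card_insert_le t S
        have h2 : #S ≤ 1 := card_le_one.2 fun x hx y hy => (hnt x hx).trans (hnt y hy).symm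
        exact (Nat.mul_le_mul_left _ (by omega)).trans (hdeg s)
  · push Not at hcn
    obtain ⟨u, v, huv, hadj, hno⟩ := hcn
    obtain ⟨S, hS, hvS, hdom, hc⟩ :=
      exists_connected_dominating_of_no_common_nbr hσ hG huv hadj hno
    exact hasTwoKST_of_connected_dominating hS ⟨v, hvS, huv.symm⟩ hdom fun s _ =>
      (Nat.mul_le_mul_left _ (by omega)).trans (hdeg s)

/-- If some vertex `a` has small degree, any set `X` of vertices of large degree extends, avoiding
a small set `P`, to a small connected set dominating all vertices of large degree. -/
theorem exists_connected_of_low_deg {a : V} (ha : 5 * deg G a < Fintype.card V)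
    (hk : 60 * k + 120 ≤ Fintype.card V) (L : ℕ) (hL : Fintype.card V < 2 ^ (L + 1)) (hL1 : 1 ≤ L)
    (X P : Finset V) (hX : ∀ x ∈ X, Fintype.card V ≤ 2 * deg G x + 2) (hXne : X.Nonempty)
    (hXP : ∀ x ∈ X, x ∉ P) (hP : #P ≤ k) :
    ∃ (S : Finset V) (r : V), ConnFrom G S r ∧ (∃ t ∈ S, t ≠ r) ∧ X ⊆ S ∧ (∀ s ∈ S, s ∉ P) ∧
      (∀ s ∈ S, Fintype.card V ≤ 2 * deg G s + 2) ∧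
      (∀ v, Fintype.card V ≤ 2 * deg G v + 2 → ∃ s ∈ S, v = s ∨ G.Adj s v) ∧
      #S ≤ 1 + 5 * (L - 1) + 2 * #X := by
  classical
  have hfar : ∀ w ∉ cnbr G a, Fintype.card V ≤ deg G a + deg G w + 2 := by
    intro w hw
    rw [mem_cnbr, not_or] at hw
    exact hσ a w (Ne.symm hw.1) hw.2
  obtain ⟨r, hr⟩ : ∃ r, r ∉ cnbr G a ∪ P := by
    by_contra! h
    have h1 := card_le_card (show univ ⊆ cnbr G a ∪ P from fun v _ => h v)
    have h2 := card_union_le (cnbr G a) P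
    rw [card_univ] at h1
    rw [card_cnbr] at h2
    omega
  rw [mem_union, not_or] at hr
  have hra : ¬ G.Adj r a := fun h => hr.1 (mem_cnbr.2 (Or.inr h.symm))
  have hdr := hfar r hr.1
  -- Off `M` lie the usable neighbours of the hub `r`; `a` is erased because `cnbr G a` already
  -- counts it.
  let M : Finset V := cnbr G a ∪ (nbr G r)ᶜ.erase a ∪ P
  have hM : #M ≤ 2 * deg G a + 2 + k := by
    have h1 : #M ≤ _ := card_union_le (cnbr G a ∪ (nbr G r)ᶜ.erase a) P
    have h2 := card_union_le (cnbr G a) ((nbr G r)ᶜ.erase a)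
    have h3 : #((nbr G r)ᶜ.erase a) + 1 = #(nbr G r)ᶜ :=
      card_erase_add_one (by simpa using hra)
    rw [card_compl, card_nbr] at h3
    rw [card_cnbr] at h2
    omega
  have hMmem : ∀ y ∈ Mᶜ, y ∉ cnbr G a ∧ G.Adj r y ∧ y ∉ P := by
    intro y hy
    simp only [M, mem_compl, mem_union, mem_erase, not_or, not_and, not_not, mem_nbr] at hy
    refine ⟨hy.1.1, hy.1.2 ?_, hy.2⟩
    rintro rfl
    exact hy.1.1 (mem_cnbr.2 (Or.inl rfl))
  have hhigh : ∀ w ∉ cnbr G a, Fintype.card V ≤ 2 * deg G w + 2 := by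
    intro w hw
    have := hfar w hw
    omega
  -- Since k + 2 ≤ n/60, #M < 2n/5 + n/60 = 5n/12, so n/2 - #M exceeds (n - #M)/7.
  have hmany : ∀ v, Fintype.card V ≤ 2 * deg G v + 2 →
      #Mᶜ ≤ 7 * #(cnbr G v \ M) ∧ (cnbr G v \ M).Nonempty := by
    intro v hv
    have h1 := le_card_sdiff M (cnbr G v)
    rw [card_cnbr] at h1
    rw [card_compl, ← card_pos]
    omega
  have hmid : ∀ v, ∃ x, Fintype.card V ≤ 2 * deg G v + 2 → x ∈ Mᶜ ∧ (v = x ∨ G.Adj x v) := by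
    intro v
    by_cases hv : Fintype.card V ≤ 2 * deg G v + 2
    · obtain ⟨x, hx⟩ := (hmany v hv).2
      rw [mem_sdiff] at hx
      exact ⟨x, fun _ => ⟨mem_compl.2 hx.2, (mem_cnbr.1 hx.1).imp Eq.symm Adj.symm⟩⟩
    · exact ⟨v, fun h => (hv h).elim⟩
  choose m hm using hmid
  have hYne : (Mᶜ).Nonempty := by
    obtain ⟨x, hx⟩ := hXne
    exact ⟨m x, (hm x (hX x hx)).1⟩
  -- The hub misses at most deg a + 1 < 2 ^ (L - 1) vertices, and 2 * 6 ^ 5 ≤ 7 ^ 5 lets five picks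
  -- at least halve what remains.
  obtain ⟨Z, hZM, hZc, hZ⟩ := exists_small_cover (fun u y : V => u = y ∨ G.Adj y u) 6 Mᶜ hYne
    (5 * (L - 1)) {u ∈ (cnbr G r)ᶜ | Fintype.card V ≤ 2 * deg G u + 2}
    (fun u hu => ⟨cnbr G u \ M, fun y hy => mem_compl.2 (mem_sdiff.1 hy).2,
      fun y hy => (mem_cnbr.1 (mem_sdiff.1 hy).1).imp Eq.symm Adj.symm,
      (hmany u (mem_filter.1 hu).2).1⟩)
    (by
      obtain ⟨l, rfl⟩ : ∃ l, L = l + 1 := ⟨L - 1, by omega⟩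
      have h1 : #{u ∈ (cnbr G r)ᶜ | Fintype.card V ≤ 2 * deg G u + 2} ≤ #(cnbr G r)ᶜ :=
        card_filter_le _ _
      rw [card_compl, card_cnbr] at h1
      rw [pow_succ, pow_succ] at hL
      have h2 : #{u ∈ (cnbr G r)ᶜ | Fintype.card V ≤ 2 * deg G u + 2} < 2 ^ l := by omega
      rw [Nat.add_sub_cancel]
      calc #{u ∈ (cnbr G r)ᶜ | Fintype.card V ≤ 2 * deg G u + 2} * 6 ^ (5 * l)
          < 2 ^ l * 6 ^ (5 * l) := Nat.mul_lt_mul_of_pos_right h2 (by positivity)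
        _ = (2 * 6 ^ 5) ^ l := by rw [pow_mul, mul_pow]
        _ ≤ (7 ^ 5) ^ l := Nat.pow_le_pow_left (by norm_num) l
        _ = (6 + 1) ^ (5 * l) := by rw [pow_mul])
  have hmemS : ∀ s, s ∈ insert r (Z ∪ (X ∪ X.image m)) →
      s = r ∨ s ∈ Mᶜ ∨ s ∈ X := by
    intro s hs
    simp only [mem_insert, mem_union, mem_image] at hs
    rcases hs with hs | hs | hs | ⟨x, hx, rfl⟩
    · exact Or.inl hs
    · exact Or.inr (Or.inl (hZM hs))
    · exact Or.inr (Or.inr hs)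
    · exact Or.inr (Or.inl (hm x (hX x hx)).1)
  have hmX : ∀ x ∈ X, m x ∈ insert r (Z ∪ (X ∪ X.image m)) := fun x hx =>
    mem_insert_of_mem (mem_union_right _ (mem_union_right _ (mem_image_of_mem m hx)))
  refine ⟨insert r (Z ∪ (X ∪ X.image m)), r,
    connFrom_of_hub (mem_insert_self _ _) fun s hs => ?_, ?_, fun x hx => ?_, fun s hs => ?_,
    fun s hs => ?_, fun v hv => ?_, ?_⟩
  · rcases hmemS s hs with rfl | h | h
    · exact ⟨s, hs, Or.inl rfl, Or.inl rfl⟩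
    · exact ⟨s, hs, Or.inr (hMmem s h).2.1, Or.inl rfl⟩
    · exact ⟨m s, hmX s h, Or.inr (hMmem _ (hm s (hX s h)).1).2.1, (hm s (hX s h)).2⟩
  · obtain ⟨x, hx⟩ := hXne
    exact ⟨m x, hmX x hx, (hMmem _ (hm x (hX x hx)).1).2.1.ne'⟩
  · exact mem_insert_of_mem (mem_union_right _ (mem_union_left _ hx))
  · rcases hmemS s hs with rfl | h | h
    · exact hr.2
    · exact (hMmem s h).2.2
    · exact hXP s h
  · rcases hmemS s hs with rfl | h | h
    · exact hhigh s hr.1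
    · exact hhigh s (hMmem s h).1
    · exact hX s h
  · by_cases hvr : v ∈ cnbr G r
    · exact ⟨r, mem_insert_self _ _, mem_cnbr.1 hvr⟩
    · obtain ⟨z, hz, hvz⟩ := hZ v (mem_filter.2 ⟨mem_compl.2 hvr, hv⟩)
      exact ⟨z, mem_insert_of_mem (mem_union_left _ hz), hvz⟩
  · have h1 := card_insert_le r (Z ∪ (X ∪ X.image m))
    have h2 := card_union_le Z (X ∪ X.image m)
    have h3 := card_union_le X (X.image m)
    have h4 : #(X.image m) ≤ #X := card_image_le
    omega

/-- The case of small minimum degree. -/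
theorem hasTwoKST_of_low_deg (hG : G.Connected) {a : V} (ha : 5 * deg G a < Fintype.card V)
    (hk : 60 * k + 120 ≤ Fintype.card V) (L : ℕ) (hL : Fintype.card V < 2 ^ (L + 1)) (hL1 : 1 ≤ L)
    (hsize : 2 * ((k + 1) * (5 * (L - 1) + 2 * k + 4)) ≤ Fintype.card V)
    (hQ : ∀ v, ∃ w, G.Adj v w ∧ k < deg G w) : HasTwoKST k G := by
  classical
  have halow : 2 * deg G a + 2 < Fintype.card V := by omega
  have hbound : ∀ {S : Finset V} {s : V}, #S ≤ 5 * (L - 1) + 2 * k + 4 →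
      Fintype.card V ≤ 2 * deg G s + 2 → (k + 1) * #S ≤ deg G s + 1 := by
    intro S s hS hs
    have := Nat.mul_le_mul_left (k + 1) hS
    omega
  by_cases hb : ∃ b, 2 * deg G b + 2 < Fintype.card V ∧ k + 1 ≤ deg G b
  · obtain ⟨b, x, hblow, hbk, hx, hbx⟩ : ∃ b x, 2 * deg G b + 2 < Fintype.card V ∧
        k + 1 ≤ deg G b ∧ Fintype.card V ≤ 2 * deg G x + 2 ∧ G.Adj b x := by
      obtain ⟨b, hblow, hbk⟩ := hb
      by_contra! hno
      obtain ⟨c, hc, x, hcx, hx⟩ : ∃ c, 2 * deg G c + 2 < Fintype.card V ∧ ∃ x, G.Adj c x ∧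
          Fintype.card V ≤ 2 * deg G x + 2 := by
        by_contra! hcl
        have hall := mem_of_connected hG {v | 2 * deg G v + 2 < Fintype.card V} (a := a) halow
          (fun c hc x hcx => hcl c hc x hcx)
        have h1 := card_le_card (show univ ⊆ cnbr G a from fun v _ => by
          rw [mem_cnbr]
          by_cases hva : v = a
          · exact Or.inl hva
          · exact Or.inr (adj_of_low_deg hσ halow (hall v) (Ne.symm hva)))
        rw [card_cnbr, card_univ] at h1
        omega
      -- With only low neighbours, `b` has degree at most that of `c`; then `c` itself has degree
      -- above k and a neighbour that is not low.
      have hsub : cnbr G b ⊆ cnbr G c := by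
        intro w hw
        have hwlow : 2 * deg G w + 2 < Fintype.card V := by
          rcases mem_cnbr.1 hw with rfl | hw
          · exact hblow
          · by_contra hlt
            exact hno b w hblow hbk (not_lt.1 hlt) hw
        rw [mem_cnbr]
        by_cases hwc : w = c
        · exact Or.inl hwc
        · exact Or.inr (adj_of_low_deg hσ hc hwlow (Ne.symm hwc))
      have h1 := card_le_card hsub
      rw [card_cnbr, card_cnbr] at h1
      exact hno c x hc (by omega) hx hcx
    -- `x` must enter S to attach `b`, so it cannot be a private neighbour of `b`.
    obtain ⟨P, hP, hPc⟩ : ∃ P ⊆ (nbr G b).erase x, #P = k := by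
      refine exists_subset_card_eq ?_
      have := card_erase_add_one (mem_nbr.2 hbx)
      rw [card_nbr] at this
      omega
    obtain ⟨S, r, hconn, -, hXS, hSP, hShigh, hdom, hSc⟩ :=
      exists_connected_of_low_deg hσ ha hk L hL hL1 {x} P (by simpa using hx) (by simp)
        (by
          intro y hy hyP
          rw [mem_singleton] at hy
          subst hy
          exact (mem_erase.1 (hP hyP)).1 rfl) hPc.le
    rw [card_singleton] at hSc
    have hbS : b ∉ S := fun h => by
      have := hShigh b h
      omega
    refine hasTwoKST_of_connected_dominating_insert (S := insert b S) (P := P) (b := b)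
      (hconn.insert_of_adj (hXS (mem_singleton_self x)) hbx.symm)
      ⟨b, mem_insert_self _ _, fun h => hbS (h ▸ hconn.1)⟩ (fun v => ?_) (mem_insert_self _ _) hPc
      (fun v hv => ?_) (fun s hs hsb => ?_)
    · by_cases hv : 2 * deg G v + 2 < Fintype.card V
      · refine ⟨b, mem_insert_self _ _, ?_⟩
        by_cases hvb : v = b
        · exact Or.inl hvb
        · exact Or.inr (adj_of_low_deg hσ hblow hv (Ne.symm hvb))
      · obtain ⟨s, hs, hvs⟩ := hdom v (not_lt.1 hv)
        exact ⟨s, mem_insert_of_mem hs, hvs⟩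
    · have hbv := mem_nbr.1 (mem_of_mem_erase (hP hv))
      refine ⟨fun h => ?_, hbv⟩
      rcases mem_insert.1 h with rfl | h
      · exact hbv.ne rfl
      · exact hSP v h hv
    · refine hbound ?_ (hShigh s ((mem_insert.1 hs).resolve_left hsb))
      have := card_insert_le b S
      omega
  · push Not at hb
    -- All low vertices now have degree at most k, so `g v`, of degree above k, is never low.
    choose g hg hgk using hQ
    let A : Finset V := {v | 2 * deg G v + 2 < Fintype.card V}
    have hA : #A ≤ k + 1 := by
      have h1 := card_le_card (show A ⊆ cnbr G a from fun v hv => by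
        rw [mem_cnbr]
        by_cases hva : v = a
        · exact Or.inl hva
        · exact Or.inr (adj_of_low_deg hσ halow (mem_filter.1 hv).2 (Ne.symm hva)))
      rw [card_cnbr] at h1
      have := hb a halow
      omega
    obtain ⟨S, r, hconn, hnt, hXS, -, hShigh, hdom, hSc⟩ :=
      exists_connected_of_low_deg hσ ha hk L hL hL1 (A.image g) ∅
        (by
          intro x hx
          obtain ⟨v, -, rfl⟩ := mem_image.1 hx
          by_contra! hlt
          have := hb (g v) hlt
          have := hgk v
          omega)
        ⟨g a, mem_image_of_mem g (mem_filter.2 ⟨mem_univ a, halow⟩)⟩ (by simp) (by simp)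
    have hXc : #(A.image g) ≤ #A := card_image_le
    refine hasTwoKST_of_connected_dominating hconn hnt (fun v => ?_)
      fun s hs => hbound (by omega) (hShigh s hs)
    by_cases hv : 2 * deg G v + 2 < Fintype.card V
    · exact ⟨g v, hXS (mem_image_of_mem g (mem_filter.2 ⟨mem_univ v, hv⟩)), Or.inr (hg v).symm⟩
    · exact hdom v (not_lt.1 hv)

end Ore

end Construction

end TwoKST

/-! ### The characterization -/

theorem theorem2 {V : Type*} [Fintype V] (k : ℕ) (hk : 2 ≤ k) (G : SimpleGraph V)
    (hG : G.Connected) (n : ℕ) (hV : Fintype.card V = n) (hn : TwoKST.n₀ k ≤ n)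
    (hσ : ((n - 2 : ℕ) : ℕ∞) ≤ TwoKST.sigma2 G) :
    TwoKST.HasTwoKST k G ↔ ¬ ∃ H ∈ TwoKST.family k n, Nonempty (G ≃g H) := by
  subst hV
  have hσ' := TwoKST.card_le_of_le_sigma2 hσ
  obtain ⟨h1, h2, h3, h4⟩ := TwoKST.size_bounds hk hn
  constructor
  · rintro hT ⟨H, hH, ⟨e⟩⟩
    obtain ⟨a, ha⟩ := TwoKST.exists_neighbors_deg_le_of_iso hH e
    exact TwoKST.not_hasTwoKST hσ' ha (by omega) hT
  · intro hnot
    have hQ : ∀ v, ∃ w, G.Adj v w ∧ k < TwoKST.deg G w := by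
      by_contra! hex
      obtain ⟨a, ha⟩ := hex
      exact hnot (TwoKST.exists_mem_family hσ' ha hG (by omega) h4)
    have hL := Nat.lt_pow_succ_log_self (b := 2) (by norm_num) (Fintype.card V)
    have hL1 : 1 ≤ Nat.log 2 (Fintype.card V) := Nat.log_pos (by norm_num) (by omega)
    by_cases hlow : ∃ a, 5 * TwoKST.deg G a < Fintype.card V
    · obtain ⟨a, ha⟩ := hlow
      exact TwoKST.hasTwoKST_of_low_deg hσ' hG ha h3 _ hL hL1 h2 hQ
    · push Not at hlow
      refine TwoKST.hasTwoKST_of_deg_ge hσ' hG _ hL hL1 fun v => ?_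
      have := hlow v
      omega
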